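/- Let $d\ge 0$, let $I\subseteq\mathbb R$ be a non-degenerate interval of times (open, closed or half-open, bounded or not; at an end point that belongs to $I$ time derivatives are one-sided). Let $\pi>0$ be a $C^1$ probability density on $\mathbb R^d$, and let $\pi_t>0$, $t\in I$, be (not necessarily normalized) densities on $\mathbb R^d$, differentiable in $x$, with $(t,x)\mapsto\nabla\log\pi_t(x)$ continuous on $I\times\mathbb R^d$. For a vector field $s$ and positive densities $f,q$ write $$L(s,f)=\mathbb E_f\|s-\nabla\log f\|^2,\qquad F(f\|q)=\mathbb E_f\Big\|\nabla\log\frac fq\Big\|^2,\qquad \mathrm{KL}(f\|q)=\mathbb E_f\log\frac fq .$$ Let $s_t$ be a time-dependent vector field, continuous in $(t,x)\in I\times\mathbb R^d$, and let $X_t$ be a random process whose paths almost surely satisfy $$\frac{dX_t}{dt}=\nabla\log\pi_t(X_t)-s_t(X_t),\qquad t\in I .$$ Suppose that $X_t$ has a density $f_t>0$ with $(t,x)\mapsto f_t(x)$ of class $C^1$ on $I\times\mathbb R^d$, that $\mathrm{KL}(f_{t}\|\pi)<\infty$ for some $t\in I$, and that, locally uniformly in $t\in I$, the functions $|\partial_tf_t|$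 and $f_t\,|\langle s_t-\nabla\log\pi_t,\nabla\log\frac{f_t}{\pi}\rangle|$ of $x$ are bounded by Lebesgue-integrable functions of $x$. (1) For every $t\in I$, $\mathrm{KL}(f_t\|\pi)<\infty$, the function $t\mapsto\mathrm{KL}(f_t\|\pi)$ is differentiable on $I$, and $$-\frac{d}{dt}\mathrm{KL}(f_t\|\pi)=\mathbb E_{f_t}\Big\langle s_t-\nabla\log\pi_t,\nabla\log\frac{f_t}{\pi}\Big\rangle ,$$ where the expectation converges absolutely. (2) For every $t\in I$ with $L(s_t,f_t)\,F(f_t\|\pi)<\infty$ (with $0\cdot\infty=0$), the expectation $\mathbb E_{f_t}\langle\nabla\log\frac{f_t}{\pi_t},\nabla\log\frac{f_t}{\pi}\rangle$ converges absolutely and $$\Big|\mathbb E_{f_t}\Big\langle s_t-\nabla\log\pi_t,\nabla\log\frac{f_t}{\pi}\Big\rangle-\mathbb E_{f_t}\Big\langle\nabla\log\frac{f_t}{\pi_t},\nabla\log\frac{f_t}{\pi}\Big\rangle\Big|\le\sqrt{L(s_t,f_t)\,F(f_t\|\pi)} .$$ (3) Consequently, as $L(s_t,f_t)\to0$ with $F(f_t\|\pi)$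 bounded, along any family of such fields $s$, processes $X$ with densities $f$, and times $t\in I$ (for fixed $\pi$ and $\pi_t$), $$-\frac{d}{dt}\mathrm{KL}(f_t\|\pi)-\mathbb E_{f_t}\Big\langle\nabla\log\frac{f_t}{\pi_t},\nabla\log\frac{f_t}{\pi}\Big\rangle\to0\quad\text{at the rate }O\big(\sqrt{L(s_t,f_t)}\big).$$ -/

import Mathlib

open MeasureTheory ProbabilityTheory InformationTheory Set Filter Topology Asymptotics
open scoped ENNReal NNReal

noncomputable section

/-- The state space `ℝ^d` with its Euclidean norm. -/
abbrev Space (d : ℕ) : Type := EuclideanSpace ℝ (Fin d)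

/-- The measure `p(x) dx` on `ℝ^d`. -/
def densityMeasure {d : ℕ} (p : Space d → ℝ) : Measure (Space d) :=
  volume.withDensity (fun x => ENNReal.ofReal (p x))

/-- The score `∇ log p`. -/
def score {d : ℕ} (p : Space d → ℝ) (x : Space d) : Space d :=
  gradient (fun y => Real.log (p y)) x

/-- The relative score `∇ log (p / q)`. -/
def relScore {d : ℕ} (p q : Space d → ℝ) (x : Space d) : Space d :=
  gradient (fun y => Real.log (p y / q y)) x

/-- The score-matching loss `L(s, p) = E_p ‖s - ∇ log p‖²`, with values in `[0, ∞]`. -/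
def scoreLoss {d : ℕ} (s : Space d → Space d) (p : Space d → ℝ) : ℝ≥0∞ :=
  ∫⁻ x, ‖s x - score p x‖ₑ ^ 2 ∂(densityMeasure p)

/-- The relative Fisher information `F(p ‖ q) = E_p ‖∇ log (p / q)‖²`, with values in `[0, ∞]`. -/
def relFisher {d : ℕ} (p q : Space d → ℝ) : ℝ≥0∞ :=
  ∫⁻ x, ‖relScore p q x‖ₑ ^ 2 ∂(densityMeasure p)

/-- The relative entropy `KL(p ‖ q)` as a real number; it is meaningful where
`klDiv (densityMeasure p) (densityMeasure q) ≠ ∞`. -/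
def relEntropy {d : ℕ} (p q : Space d → ℝ) : ℝ :=
  (klDiv (densityMeasure p) (densityMeasure q)).toReal

/-- `X` is a random solution, over the time interval `I`, of the ordinary differential equation
`dX_t/dt = ∇ log π_t (X_t) - s_t (X_t)`, the random variable `X_t` has the density `f_t`, and
the data are regular and decay at infinity (locally uniformly in time) as is needed for
`KL(f_t ‖ π)` and its dissipation to make sense. -/
structure IsAnnealedDynamics {d : ℕ} (I : Set ℝ) (π : Space d → ℝ) (πt : ℝ → Space d → ℝ)
    (s : ℝ → Space d → Space d) (f : ℝ → Space d → ℝ)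
    {Ω : Type*} [MeasurableSpace Ω] (P : Measure Ω) (X : ℝ → Ω → Space d) : Prop where
  /-- Almost every path solves the equation. -/
  ode : ∀ᵐ ω ∂P, ∀ t ∈ I,
    HasDerivWithinAt (fun τ => X τ ω) (score (πt t) (X t ω) - s t (X t ω)) I t
  /-- `f_t` is the density of `X_t`. -/
  law : ∀ t ∈ I, HasLaw (X t) (densityMeasure (f t)) P
  /-- The vector field `s` is continuous in time and space. -/
  continuousOn_field : ContinuousOn (fun z : ℝ × Space d => s z.1 z.2) (I ×ˢ univ)
  /-- The density `f` is positive. -/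
  pos : ∀ t ∈ I, ∀ x, 0 < f t x
  /-- The density `f` is continuously differentiable in time and space. -/
  contDiffOn : ContDiffOn ℝ 1 (fun z : ℝ × Space d => f z.1 z.2) (I ×ˢ univ)
  /-- The relative entropy is finite at some time. -/
  finite_entropy : ∃ t ∈ I, klDiv (densityMeasure (f t)) (densityMeasure π) ≠ ∞
  /-- Locally in time, `∂_t f_t` has an integrable majorant. -/
  dominated_deriv : ∀ t₀ ∈ I, ∃ g : Space d → ℝ, Integrable g ∧
    ∀ᶠ t in 𝓝[I] t₀, ∀ x, |derivWithin (fun τ => f τ x) I t| ≤ g x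
  /-- Locally in time, `f_t ⟨s_t - ∇ log π_t, ∇ log (f_t / π)⟩` has an integrable majorant. -/
  dominated_dissipation : ∀ t₀ ∈ I, ∃ g : Space d → ℝ, Integrable g ∧
    ∀ᶠ t in 𝓝[I] t₀, ∀ x,
      f t x * |inner ℝ (s t x - score (πt t) x) (relScore (f t) π x)| ≤ g x

end

/-! Since `X_t` moves with velocity `∇ log π_t - s_t`, the chain rule along a path gives `∂_t f_t /
f_t - ⟨s_t - ∇ log π_t, ∇ log (f_t / π)⟩`, evaluated at `X_t`, as the time derivative of `log (f_t /
π) (X_t)` (`hasDerivWithinAt_log_div_comp_path`). The first term has expectation `∫ ∂_t f_t dx`,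
whose integral over `[a, b]` vanishes because `f_a` and `f_b` both have mass one
(`integral_integral_derivWithin`). Hence the expected change of the log-ratio is minus the time
integral of the dissipation (`integrable_and_integral_log_ratio_sub`). Neither the continuity
equation nor an integration by parts in space is needed.

The two integrable majorants justify Fubini and make the dissipation continuous in time, so that the
integrated identity can be differentiated, one-sidedly at end points. Because it is the difference
of log-ratios that is shown integrable, finiteness of the entropy passes from one time to all
others.

The estimate comes from `s_t - ∇ log π_t = (s_t - ∇ log f_t) + ∇ log (f_t / π_t)` and Cauchy–Schwarz
for the first summand; the rate follows with constant the square root of the bound on the Fisher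
information. -/

/-! ### Joint measurability, Fubini and calculus in time. -/

/-- A process with a.s. continuous paths on `[a, b]` and measurable marginals has a jointly
measurable modification. -/
theorem exists_measurable_uncurry_modification {E Ω : Type*} [NormedAddCommGroup E]
    [MeasurableSpace E] [BorelSpace E] [MeasurableSpace Ω] {P : Measure Ω} {X : ℝ → Ω → E}
    {a b : ℝ} (hab : a ≤ b) (hm : ∀ t ∈ Icc a b, AEMeasurable (X t) P)
    (hc : ∀ᵐ ω ∂P, ContinuousOn (fun t => X t ω) (Icc a b)) :
    ∃ Y : ℝ → Ω → E, Measurable (Function.uncurry Y) ∧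
      ∀ᵐ ω ∂P, ∀ t ∈ Icc a b, Y t ω = X t ω := by
  have hne : Nonempty (Icc a b) := ⟨⟨a, left_mem_Icc.2 hab⟩⟩
  let u := TopologicalSpace.denseSeq (Icc a b)
  have hmk : ∀ᵐ ω ∂P, ∀ n, X (u n) ω = (hm (u n) (u n).2).mk _ ω :=
    ae_all_iff.2 fun n => (hm (u n) (u n).2).ae_eq_mk
  -- Off a measurable set of full measure the process is set to zero. Every path is then continuous,
  -- and measurability at the countable dense set of times passes to all times by limits.
  obtain ⟨G, hG, hGm, hGP⟩ := (hc.and hmk).exists_measurable_mem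
  let Y : Icc a b → Ω → E := fun t => G.indicator (X t)
  have hYc : ∀ ω, Continuous fun t => Y t ω := by
    intro ω
    by_cases h : ω ∈ G
    · simp only [Y, indicator_of_mem h]
      exact (hGP ω h).1.domRestrict
    · simp only [Y, indicator_of_notMem h]
      exact continuous_const
  have hYu : ∀ n, Measurable (Y (u n)) := by
    intro n
    have : Y (u n) = G.indicator ((hm (u n) (u n).2).mk _) :=
      indicator_congr fun ω h => (hGP ω h).2 n
    rw [this]
    exact (hm (u n) (u n).2).measurable_mk.indicator hGm
  have hYm : ∀ t, Measurable (Y t) := by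
    intro t
    obtain ⟨v, hv, hvt⟩ := mem_closure_iff_seq_limit.1
      (TopologicalSpace.denseRange_denseSeq (Icc a b) t)
    refine measurable_of_tendsto_metrizable (f := fun n => Y (v n)) (fun n => ?_)
      (tendsto_pi_nhds.2 fun ω => ((hYc ω).tendsto t).comp hvt)
    obtain ⟨k, hk⟩ := hv n
    rw [← hk]
    exact hYu k
  refine ⟨fun t => Y (projIcc a b hab t), ?_, ?_⟩
  · exact (measurable_uncurry_of_continuous_of_measurable hYc hYm).comp
      (((continuous_projIcc (h := hab)).measurable.comp measurable_fst).prodMk measurable_snd)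
  · filter_upwards [hG] with ω hω t ht
    simp only [Y, projIcc_of_mem hab ht, indicator_of_mem hω]

/-- The remainder is the integral of `D r - D t` between `t` and `u`, where `r` stays in `I` and is
as close to `t` as `u` is. This treats interior points and end points of `I` alike. -/
theorem hasDerivWithinAt_of_eq_intervalIntegral {I : Set ℝ} (hI : I.OrdConnected) {K D : ℝ → ℝ}
    (hD : ContinuousOn D I) {t : ℝ} (ht : t ∈ I)
    (h : ∀ u ∈ I, K u - K t = ∫ r in t..u, D r) : HasDerivWithinAt K (D t) I t := by
  rw [hasDerivWithinAt_iff_isLittleO, isLittleO_iff]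
  intro c hc
  obtain ⟨δ, hδ, hδc⟩ := Metric.continuousWithinAt_iff.1 (hD t ht) c hc
  filter_upwards [self_mem_nhdsWithin, mem_nhdsWithin_of_mem_nhds (Metric.ball_mem_nhds t hδ)]
    with u hu hut
  have hsub : uIcc t u ⊆ I := hI.uIcc_subset ht hu
  have hi : IntervalIntegrable D volume t u := (hD.mono hsub).intervalIntegrable
  have e : K u - K t - (u - t) • D t = ∫ r in t..u, (D r - D t) := by
    rw [intervalIntegral.integral_sub hi intervalIntegrable_const, h u hu]
    simp
  rw [e]
  refine (intervalIntegral.norm_integral_le_of_norm_le_const fun r hr => ?_).trans_eq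
    (by rw [Real.norm_eq_abs (u - t)])
  have hr' := uIoc_subset_uIcc hr
  have : dist r t < δ := by
    rw [Metric.mem_ball] at hut
    rw [Real.dist_eq] at hut ⊢
    exact (abs_sub_left_of_mem_uIcc hr').trans_lt hut
  simpa [Real.dist_eq] using (hδc (hsub hr') this).le

/-- Fubini: a bound on the `L¹` norms that is uniform over a time interval of finite length gives
integrability on the product. It serves both for paths, with `μ` the probability, and for `∂_t f`,
with `μ` Lebesgue measure. -/
theorem integrable_and_integral_eq_of_ae_eq_intervalIntegral {Ω : Type*} [MeasurableSpace Ω]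
    {μ : Measure Ω} [SFinite μ] {Z : ℝ → Ω → ℝ} {a b : ℝ} (hab : a ≤ b)
    (hZ : AEStronglyMeasurable (Function.uncurry Z) ((volume.restrict (Ioc a b)).prod μ))
    {C : ℝ} (hint : ∀ t ∈ Ioc a b, Integrable (Z t) μ) (hC : ∀ t ∈ Ioc a b, ∫ ω, ‖Z t ω‖ ∂μ ≤ C)
    {W : Ω → ℝ} (hW : ∀ᵐ ω ∂μ, W ω = ∫ t in a..b, Z t ω) :
    Integrable W μ ∧ IntervalIntegrable (fun t => ∫ ω, Z t ω ∂μ) volume a b ∧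
      ∫ ω, W ω ∂μ = ∫ t in a..b, ∫ ω, Z t ω ∂μ := by
  have hZi : Integrable (Function.uncurry Z) ((volume.restrict (Ioc a b)).prod μ) := by
    rw [integrable_prod_iff hZ]
    refine ⟨ae_restrict_of_forall_mem measurableSet_Ioc hint, ?_⟩
    refine Integrable.of_bound hZ.norm.integral_prod_right' C
      (ae_restrict_of_forall_mem measurableSet_Ioc fun t ht => ?_)
    rw [Real.norm_of_nonneg (integral_nonneg fun _ => norm_nonneg _)]
    exact hC t ht
  have hW' : W =ᵐ[μ] fun ω => ∫ t in Ioc a b, Z t ω := by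
    filter_upwards [hW] with ω hω
    rw [hω, intervalIntegral.integral_of_le hab]
  refine ⟨hZi.integral_prod_right.congr hW'.symm,
    (intervalIntegrable_iff_integrableOn_Ioc_of_le hab).2 hZi.integral_prod_left, ?_⟩
  rw [integral_congr_ae hW', intervalIntegral.integral_of_le hab]
  exact (integral_integral_swap hZi).symm

/-- Locally uniform integrable majorants on a compact set give a single majorant. -/
theorem IsCompact.exists_integrable_majorant {Ω : Type*} [MeasurableSpace Ω] {μ : Measure Ω}
    {I K : Set ℝ} (hK : IsCompact K) (hKI : K ⊆ I) {Z : ℝ → Ω → ℝ}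
    (h : ∀ t₀ ∈ I, ∃ g : Ω → ℝ, Integrable g μ ∧ ∀ᶠ t in 𝓝[I] t₀, ∀ x, |Z t x| ≤ g x) :
    ∃ g : Ω → ℝ, Integrable g μ ∧ ∀ t ∈ K, ∀ x, |Z t x| ≤ g x := by
  refine hK.induction_on
    (p := fun T => ∃ g : Ω → ℝ, Integrable g μ ∧ ∀ t ∈ T, ∀ x, |Z t x| ≤ g x)
    ⟨0, integrable_zero _ _ _, by simp⟩ ?_ ?_ ?_
  · rintro T T' hT ⟨g, hg, hgT⟩
    exact ⟨g, hg, fun t ht => hgT t (hT ht)⟩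
  · rintro T T' ⟨g, hg, hgT⟩ ⟨g', hg', hgT'⟩
    refine ⟨g ⊔ g', hg.sup hg', ?_⟩
    rintro t (ht | ht) x
    · exact (hgT t ht x).trans le_sup_left
    · exact (hgT' t ht x).trans le_sup_right
  · intro t ht
    obtain ⟨g, hg, hgt⟩ := h t (hKI ht)
    exact ⟨_, nhdsWithin_mono _ hKI hgt, g, hg, fun _ h => h⟩

theorem intervalIntegral_eq_sub_of_hasDerivWithinAt {I : Set ℝ} {a b : ℝ} (hab : a ≤ b)
    (hsub : Icc a b ⊆ I) {G G' : ℝ → ℝ} (hG : ∀ t ∈ I, HasDerivWithinAt G (G' t) I t)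
    (hG' : ContinuousOn G' (Icc a b)) : ∫ t in a..b, G' t = G b - G a :=
  intervalIntegral.integral_eq_sub_of_hasDerivAt_of_le hab
    (fun t ht => (hG t (hsub ht)).continuousWithinAt.mono hsub)
    (fun t ht => (hG t (hsub (Ioo_subset_Icc_self ht))).hasDerivAt
      (mem_of_superset (Icc_mem_nhds ht.1 ht.2) hsub))
    (ContinuousOn.intervalIntegrable (by rwa [uIcc_of_le hab]))

/-! ### Scores, density measures and relative entropy. -/

section Density

variable {d : ℕ} {p q : Space d → ℝ}

theorem inner_score {x : Space d} (hp : DifferentiableAt ℝ p x) (hx : p x ≠ 0) (v : Space d) :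
    inner ℝ (score p x) v = (p x)⁻¹ * fderiv ℝ p x v := by
  rw [score, inner_gradient_left, (hp.hasFDerivAt.log hx).fderiv]
  simp

theorem score_eq {x : Space d} (hp : DifferentiableAt ℝ p x) (hx : p x ≠ 0) :
    score p x = (p x)⁻¹ • gradient p x := by
  refine ext_inner_right ℝ fun v => ?_
  rw [inner_score hp hx, real_inner_smul_left, inner_gradient_left]

theorem relScore_eq {x : Space d} (hp : DifferentiableAt ℝ p x) (hq : DifferentiableAt ℝ q x)
    (hp₀ : ∀ y, 0 < p y) (hq₀ : ∀ y, 0 < q y) : relScore p q x = score p x - score q x := by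
  have e : (fun y => Real.log (p y / q y)) = (fun y => Real.log (p y)) - fun y => Real.log (q y) :=
    funext fun y => Real.log_div (hp₀ y).ne' (hq₀ y).ne'
  rw [relScore, score, score, e, gradient, gradient, gradient,
    fderiv_sub (hp.log (hp₀ x).ne') (hq.log (hq₀ x).ne'), map_sub]

theorem continuous_score (hp : ContDiff ℝ 1 p) (hp₀ : ∀ y, 0 < p y) : Continuous (score p) := by
  have e : score p = fun x => (p x)⁻¹ • (InnerProductSpace.toDual ℝ _).symm (fderiv ℝ p x) :=
    funext fun x => score_eq (hp.differentiable one_ne_zero x) (hp₀ x).ne'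
  rw [e]
  exact (hp.continuous.inv₀ fun x => (hp₀ x).ne').smul
    ((LinearIsometryEquiv.continuous _).comp (hp.continuous_fderiv one_ne_zero))

theorem integrable_densityMeasure_iff (hp : Measurable p) (hp₀ : ∀ y, 0 < p y) {g : Space d → ℝ} :
    Integrable g (densityMeasure p) ↔ Integrable fun x => p x * g x := by
  rw [densityMeasure, integrable_withDensity_iff_integrable_smul' hp.ennreal_ofReal
    (ae_of_all _ fun _ => ENNReal.ofReal_lt_top)]
  simp [ENNReal.toReal_ofReal (hp₀ _).le]

theorem integral_densityMeasure (hp : Measurable p) (hp₀ : ∀ y, 0 < p y) (g : Space d → ℝ) :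
    ∫ x, g x ∂(densityMeasure p) = ∫ x, p x * g x := by
  rw [densityMeasure, integral_withDensity_eq_integral_toReal_smul hp.ennreal_ofReal
    (ae_of_all _ fun _ => ENNReal.ofReal_lt_top)]
  simp [ENNReal.toReal_ofReal (hp₀ _).le]

theorem densityMeasure_absolutelyContinuous (hq : Measurable q) (hq₀ : ∀ y, 0 < q y) :
    densityMeasure p ≪ densityMeasure q :=
  (withDensity_absolutelyContinuous _ _).trans
    (withDensity_absolutelyContinuous' hq.ennreal_ofReal.aemeasurable
      (ae_of_all _ fun x => (ENNReal.ofReal_pos.2 (hq₀ x)).ne'))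

theorem isProbabilityMeasure_densityMeasure (hq₀ : ∀ y, 0 < q y) (hq : ∫ x, q x = 1) :
    IsProbabilityMeasure (densityMeasure q) := by
  have hi : Integrable q := by
    by_contra h
    simp [integral_undef h] at hq
  constructor
  rw [densityMeasure, withDensity_apply _ MeasurableSet.univ, Measure.restrict_univ,
    ← ofReal_integral_eq_lintegral_ofReal hi (ae_of_all _ fun x => (hq₀ x).le), hq,
    ENNReal.ofReal_one]

theorem integrable_and_integral_eq_one (hp : Measurable p) (hp₀ : ∀ y, 0 < p y)
    [IsProbabilityMeasure (densityMeasure p)] : Integrable p ∧ ∫ x, p x = 1 := by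
  have h1 : Integrable (fun _ => (1 : ℝ)) (densityMeasure p) := integrable_const _
  have h2 : ∫ _, (1 : ℝ) ∂(densityMeasure p) = 1 := by simp
  rw [integrable_densityMeasure_iff hp hp₀] at h1
  rw [integral_densityMeasure hp hp₀] at h2
  simpa using And.intro h1 h2

/-- Both Radon–Nikodym derivatives are computed against Lebesgue measure; positivity of `q` allows
the division. -/
theorem llr_densityMeasure (hp : Measurable p) (hp₀ : ∀ y, 0 < p y) (hq : Measurable q)
    (hq₀ : ∀ y, 0 < q y) [IsProbabilityMeasure (densityMeasure p)] :
    llr (densityMeasure p) (densityMeasure q) =ᵐ[densityMeasure p]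
      fun x => Real.log (p x / q x) := by
  refine (withDensity_absolutelyContinuous volume _).ae_le ?_
  have h1 := Measure.rnDeriv_withDensity_right (densityMeasure p) (volume : Measure (Space d))
    hq.ennreal_ofReal.aemeasurable (ae_of_all _ fun x => (ENNReal.ofReal_pos.2 (hq₀ x)).ne')
    (ae_of_all _ fun x => ENNReal.ofReal_ne_top)
  have h2 := Measure.rnDeriv_withDensity (volume : Measure (Space d)) hp.ennreal_ofReal
  filter_upwards [h1, h2] with x hx1 hx2
  rw [llr, densityMeasure, densityMeasure]
  rw [densityMeasure] at hx1
  rw [hx1, hx2]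
  congr 1
  rw [ENNReal.toReal_mul, ENNReal.toReal_inv, ENNReal.toReal_ofReal (hp₀ x).le,
    ENNReal.toReal_ofReal (hq₀ x).le]
  ring

theorem klDiv_densityMeasure_ne_top_iff (hp : Measurable p) (hp₀ : ∀ y, 0 < p y)
    (hq : Measurable q) (hq₀ : ∀ y, 0 < q y) [IsProbabilityMeasure (densityMeasure p)] :
    klDiv (densityMeasure p) (densityMeasure q) ≠ ∞ ↔
      Integrable (fun x => Real.log (p x / q x)) (densityMeasure p) := by
  rw [klDiv_ne_top_iff, integrable_congr (llr_densityMeasure hp hp₀ hq hq₀)]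
  exact and_iff_right (densityMeasure_absolutelyContinuous hq hq₀)

/-- In general `klDiv` carries a correction by the difference of total masses; it cancels here
because both masses are one. -/
theorem relEntropy_eq_integral (hp : Measurable p) (hp₀ : ∀ y, 0 < p y)
    (hq : Measurable q) (hq₀ : ∀ y, 0 < q y) [IsProbabilityMeasure (densityMeasure p)]
    [IsProbabilityMeasure (densityMeasure q)] :
    relEntropy p q = ∫ x, Real.log (p x / q x) ∂(densityMeasure p) := by
  rw [relEntropy, toReal_klDiv_of_measure_eq (densityMeasure_absolutelyContinuous hq hq₀)
    (by simp), integral_congr_ae (llr_densityMeasure hp hp₀ hq hq₀)]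

end Density

/-! ### Cauchy–Schwarz with extended-real factors. -/

/-- Cauchy–Schwarz, allowing one of the two factors to be infinite if the other one vanishes. -/
theorem integrable_inner_and_abs_integral_inner_le {α E : Type*} [MeasurableSpace α]
    {μ : Measure α} [NormedAddCommGroup E] [InnerProductSpace ℝ E] {u v : α → E}
    (hu : AEStronglyMeasurable u μ) (hv : AEStronglyMeasurable v μ)
    (h : (∫⁻ x, ‖u x‖ₑ ^ 2 ∂μ) * ∫⁻ x, ‖v x‖ₑ ^ 2 ∂μ ≠ ∞) :
    Integrable (fun x => inner ℝ (u x) (v x)) μ ∧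
      |∫ x, inner ℝ (u x) (v x) ∂μ| ≤
        √((∫⁻ x, ‖u x‖ₑ ^ 2 ∂μ) * ∫⁻ x, ‖v x‖ₑ ^ 2 ∂μ).toReal := by
  -- Hölder in `[0, ∞]` needs no finiteness of the separate factors, so the convention `0 · ∞ = 0`
  -- covers the degenerate case.
  have hle : ∫⁻ x, ‖(inner ℝ (u x) (v x) : ℝ)‖ₑ ∂μ ≤
      ((∫⁻ x, ‖u x‖ₑ ^ 2 ∂μ) * ∫⁻ x, ‖v x‖ₑ ^ 2 ∂μ) ^ (1 / 2 : ℝ) := by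
    have := ENNReal.lintegral_mul_le_Lp_mul_Lq μ Real.HolderConjugate.two_two hu.enorm hv.enorm
    rw [ENNReal.mul_rpow_of_nonneg _ _ (by norm_num)]
    simp only [ENNReal.rpow_two] at this
    refine le_trans (lintegral_mono fun x => ?_) this
    rw [Pi.mul_apply, ← ofReal_norm, ← ofReal_norm, ← ofReal_norm,
      ← ENNReal.ofReal_mul (norm_nonneg _)]
    exact ENNReal.ofReal_le_ofReal (norm_inner_le_norm _ _)
  have htop := ENNReal.rpow_ne_top_of_nonneg (y := 1 / 2) (by norm_num) h
  refine ⟨⟨hu.inner hv, hle.trans_lt htop.lt_top⟩, ?_⟩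
  rw [Real.sqrt_eq_rpow, ENNReal.toReal_rpow, ← Real.norm_eq_abs, ← toReal_enorm]
  exact ENNReal.toReal_mono htop ((enorm_integral_le_lintegral_enorm _).trans hle)

/-! ### Partial derivatives of a jointly `C¹` density. -/

section TimeDependentDensity

variable {d : ℕ} {I : Set ℝ} {f : ℝ → Space d → ℝ}

theorem Set.OrdConnected.uniqueDiffOn_real (hI : I.OrdConnected) (hI' : I.Nontrivial) :
    UniqueDiffOn ℝ I :=
  uniqueDiffOn_convex hI.convex (hI.convex.nontrivial_iff_nonempty_interior.1 hI')

theorem hasDerivWithinAt_time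
    (hf : ContDiffOn ℝ 1 (fun z : ℝ × Space d => f z.1 z.2) (I ×ˢ univ)) {t : ℝ} (ht : t ∈ I)
    (x : Space d) : HasDerivWithinAt (fun τ => f τ x)
      (fderivWithin ℝ (fun z : ℝ × Space d => f z.1 z.2) (I ×ˢ univ) (t, x) (1, 0)) I t := by
  have h := (hf.differentiableOn one_ne_zero (t, x) ⟨ht, mem_univ x⟩).hasFDerivWithinAt
  exact h.comp_hasDerivWithinAt (f := fun τ => (τ, x)) t
    ((hasDerivWithinAt_id t I).prodMk (hasDerivWithinAt_const t I x))
    fun τ hτ => ⟨hτ, mem_univ x⟩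

theorem hasFDerivAt_space
    (hf : ContDiffOn ℝ 1 (fun z : ℝ × Space d => f z.1 z.2) (I ×ˢ univ)) {t : ℝ} (ht : t ∈ I)
    (x : Space d) : HasFDerivAt (f t)
      ((fderivWithin ℝ (fun z : ℝ × Space d => f z.1 z.2) (I ×ˢ univ) (t, x)).comp
        (ContinuousLinearMap.inr ℝ ℝ (Space d))) x := by
  have h := (hf.differentiableOn one_ne_zero (t, x) ⟨ht, mem_univ x⟩).hasFDerivWithinAt
  rw [← hasFDerivWithinAt_univ]
  exact h.comp (f := fun y => (t, y)) x
    (hasFDerivAt_prodMk_right t x).hasFDerivWithinAt fun y _ => ⟨ht, mem_univ y⟩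

theorem contDiff_space
    (hf : ContDiffOn ℝ 1 (fun z : ℝ × Space d => f z.1 z.2) (I ×ˢ univ)) {t : ℝ} (ht : t ∈ I) :
    ContDiff ℝ 1 (f t) := by
  rw [← contDiffOn_univ]
  exact hf.comp (g := fun z : ℝ × Space d => f z.1 z.2) (f := fun y => (t, y))
    (contDiff_prodMk_right t).contDiffOn fun y _ => ⟨ht, mem_univ y⟩

theorem continuousOn_derivWithin_time (hI : UniqueDiffOn ℝ I)
    (hf : ContDiffOn ℝ 1 (fun z : ℝ × Space d => f z.1 z.2) (I ×ˢ univ)) :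
    ContinuousOn (fun z : ℝ × Space d => derivWithin (fun τ => f τ z.2) I z.1) (I ×ˢ univ) := by
  have h := hf.continuousOn_fderivWithin (hI.prod uniqueDiffOn_univ) le_rfl
  refine (h.clm_apply (continuousOn_const (c := ((1 : ℝ), (0 : Space d))))).congr ?_
  rintro ⟨t, x⟩ ⟨ht, -⟩
  exact (hasDerivWithinAt_time hf ht x).derivWithin (hI t ht)

theorem continuousOn_score (hI : UniqueDiffOn ℝ I)
    (hf : ContDiffOn ℝ 1 (fun z : ℝ × Space d => f z.1 z.2) (I ×ˢ univ))
    (hf₀ : ∀ t ∈ I, ∀ x, 0 < f t x) :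
    ContinuousOn (fun z : ℝ × Space d => score (f z.1) z.2) (I ×ˢ univ) := by
  have h := hf.continuousOn_fderivWithin (hI.prod uniqueDiffOn_univ) le_rfl
  have h2 : ContinuousOn (fun z : ℝ × Space d => (f z.1 z.2)⁻¹ •
      (InnerProductSpace.toDual ℝ (Space d)).symm
        ((fderivWithin ℝ (fun z : ℝ × Space d => f z.1 z.2) (I ×ˢ univ) z).comp
        (ContinuousLinearMap.inr ℝ ℝ (Space d)))) (I ×ˢ univ) :=
    (hf.continuousOn.inv₀ fun z hz => (hf₀ z.1 hz.1 z.2).ne').smul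
      ((LinearIsometryEquiv.continuous _).comp_continuousOn
        (h.clm_comp continuousOn_const))
  refine h2.congr ?_
  rintro ⟨t, x⟩ ⟨ht, -⟩
  have h3 := hasFDerivAt_space hf ht x
  simp only
  rw [score_eq h3.differentiableAt (hf₀ t ht x).ne', gradient, h3.fderiv]

theorem continuousOn_relScore {q : Space d → ℝ} (hI : UniqueDiffOn ℝ I)
    (hf : ContDiffOn ℝ 1 (fun z : ℝ × Space d => f z.1 z.2) (I ×ˢ univ))
    (hf₀ : ∀ t ∈ I, ∀ x, 0 < f t x) (hq : ContDiff ℝ 1 q) (hq₀ : ∀ x, 0 < q x) :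
    ContinuousOn (fun z : ℝ × Space d => relScore (f z.1) q z.2) (I ×ˢ univ) := by
  refine ((continuousOn_score hI hf hf₀).sub
    ((continuous_score hq hq₀).comp continuous_snd).continuousOn).congr ?_
  rintro ⟨t, x⟩ ⟨ht, -⟩
  exact relScore_eq ((contDiff_space hf ht).differentiable one_ne_zero x)
    (hq.differentiable one_ne_zero x) (hf₀ t ht) hq₀

/-- The log-density ratio `log (f_t / q)` along a path. -/
theorem hasDerivWithinAt_log_div_comp_path {q : Space d → ℝ} (hI : UniqueDiffOn ℝ I)
    (hf : ContDiffOn ℝ 1 (fun z : ℝ × Space d => f z.1 z.2) (I ×ˢ univ))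
    (hf₀ : ∀ t ∈ I, ∀ x, 0 < f t x) (hq : ContDiff ℝ 1 q) (hq₀ : ∀ x, 0 < q x)
    {γ : ℝ → Space d} {v : Space d} {t : ℝ} (ht : t ∈ I) (hγ : HasDerivWithinAt γ v I t) :
    HasDerivWithinAt (fun τ => Real.log (f τ (γ τ) / q (γ τ)))
      (derivWithin (fun τ => f τ (γ t)) I t / f t (γ t) + inner ℝ v (relScore (f t) q (γ t)))
      I t := by
  have hF := (hf.differentiableOn one_ne_zero (t, γ t) ⟨ht, mem_univ _⟩).hasFDerivWithinAt
  have hs := hasFDerivAt_space hf ht (γ t)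
  have h1 : HasDerivWithinAt (fun τ => f τ (γ τ)) _ I t :=
    hF.comp_hasDerivWithinAt (f := fun τ => (τ, γ τ)) t ((hasDerivWithinAt_id t I).prodMk hγ)
      fun τ hτ => ⟨hτ, mem_univ _⟩
  have hqd := hq.differentiable one_ne_zero (γ t)
  have h2 : HasDerivWithinAt (fun τ => q (γ τ)) (fderiv ℝ q (γ t) v) I t :=
    hqd.hasFDerivAt.comp_hasDerivWithinAt t hγ
  have h3 := (h1.log (hf₀ t ht _).ne').sub (h2.log (hq₀ _).ne')
  refine (h3.congr_deriv ?_).congr_of_mem (fun τ hτ => ?_) ht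
  · rw [relScore_eq hs.differentiableAt hqd (hf₀ t ht) hq₀, real_inner_comm, inner_sub_left,
      inner_score hs.differentiableAt (hf₀ t ht _).ne', inner_score hqd (hq₀ _).ne',
      (hasDerivWithinAt_time hf ht (γ t)).derivWithin (hI t ht), hs.fderiv]
    -- The space-time velocity of the path splits into the partial derivative in time and the
    -- spatial derivative along `v`.
    have e : ((1 : ℝ), v) = (1, 0) + (0, v) := by simp
    simp only [e, map_add, ContinuousLinearMap.comp_apply, ContinuousLinearMap.inr_apply]
    ring
  · exact Real.log_div (hf₀ τ hτ _).ne' (hq₀ _).ne'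

end TimeDependentDensity

/-! ### Continuous functions of time and space, evaluated along processes. -/

theorem ContinuousOn.continuous_slice {E F : Type*} [TopologicalSpace E] [TopologicalSpace F]
    {I : Set ℝ} {G : ℝ → E → F}
    (hG : ContinuousOn (fun z : ℝ × E => G z.1 z.2) (I ×ˢ univ)) {t : ℝ} (ht : t ∈ I) :
    Continuous (G t) :=
  hG.comp_continuous (f := fun x : E => (t, x)) (by fun_prop) fun x => ⟨ht, mem_univ x⟩

theorem ContinuousOn.comp_path {E F : Type*} [TopologicalSpace E] [TopologicalSpace F]
    {I J : Set ℝ} {G : ℝ → E → F}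
    (hG : ContinuousOn (fun z : ℝ × E => G z.1 z.2) (I ×ˢ univ)) (hJ : J ⊆ I) {γ : ℝ → E}
    (hγ : ContinuousOn γ J) : ContinuousOn (fun t => G t (γ t)) J :=
  hG.comp (f := fun t => (t, γ t)) (continuousOn_id.prodMk hγ) fun _ ht => ⟨hJ ht, mem_univ _⟩

/-- Joint measurability of a continuous function of time and a continuous process. -/
theorem aestronglyMeasurable_uncurry_comp_process {E Ω : Type*} [NormedAddCommGroup E]
    [MeasurableSpace E] [BorelSpace E] [SecondCountableTopology E] [MeasurableSpace Ω]
    {P : Measure Ω} [SFinite P] {X : ℝ → Ω → E} {G : ℝ → E → ℝ} {a b : ℝ} (hab : a ≤ b)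
    (hG : ContinuousOn (fun z : ℝ × E => G z.1 z.2) (Icc a b ×ˢ univ))
    (hm : ∀ t ∈ Icc a b, AEMeasurable (X t) P)
    (hc : ∀ᵐ ω ∂P, ContinuousOn (fun t => X t ω) (Icc a b)) :
    AEStronglyMeasurable (Function.uncurry fun t ω => G t (X t ω))
      ((volume.restrict (Ioc a b)).prod P) := by
  classical
  obtain ⟨Y, hY, hYX⟩ := exists_measurable_uncurry_modification hab hm hc
  have hS : MeasurableSet (Icc a b ×ˢ (univ : Set E)) := measurableSet_Icc.prod .univ
  -- Nothing is known of `G` outside the strip, so it is extended by zero to a globally measurable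
  -- function.
  have hG' : Measurable ((Icc a b ×ˢ univ).piecewise (fun z : ℝ × E => G z.1 z.2) 0) :=
    hG.measurable_piecewise continuousOn_const hS
  refine ⟨_, (hG'.comp (measurable_fst.prodMk hY)).stronglyMeasurable, ?_⟩
  have h1 : ∀ᵐ z ∂((volume.restrict (Ioc a b)).prod P), z.1 ∈ Ioc a b :=
    Measure.quasiMeasurePreserving_fst.ae (ae_restrict_mem measurableSet_Ioc)
  have h2 : ∀ᵐ z ∂((volume.restrict (Ioc a b)).prod P), ∀ t ∈ Icc a b, Y t z.2 = X t z.2 :=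
    Measure.quasiMeasurePreserving_snd.ae hYX
  filter_upwards [h1, h2] with z hz1 hz2
  have hz := Ioc_subset_Icc_self hz1
  have : (z.1, Function.uncurry Y z) ∈ Icc a b ×ˢ (univ : Set E) := ⟨hz, mem_univ _⟩
  simp only [Function.comp_apply, piecewise_eq_of_mem _ _ _ this]
  simp only [Function.uncurry, hz2 _ hz]

/-! ### Continuity of the dissipation, conservation of mass, and the expected change of the
log-ratio. -/

/-- The entropy dissipation `E_f ⟨s - ∇ log p, ∇ log (f / q)⟩`. -/
noncomputable def dissipation {d : ℕ} (s : Space d → Space d) (p q f : Space d → ℝ) : ℝ :=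
  ∫ x, inner ℝ (s x - score p x) (relScore f q x) ∂(densityMeasure f)

namespace IsAnnealedDynamics

variable {d : ℕ} {I : Set ℝ} {π : Space d → ℝ} {πt : ℝ → Space d → ℝ}
  {s : ℝ → Space d → Space d} {f : ℝ → Space d → ℝ} {Ω : Type*} [MeasurableSpace Ω]
  {P : Measure Ω} {X : ℝ → Ω → Space d}

theorem measurable_density (H : IsAnnealedDynamics I π πt s f P X) {t : ℝ} (ht : t ∈ I) :
    Measurable (f t) :=
  (contDiff_space H.contDiffOn ht).continuous.measurable

theorem isProbabilityMeasure [IsProbabilityMeasure P] (H : IsAnnealedDynamics I π πt s f P X)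
    {t : ℝ} (ht : t ∈ I) : IsProbabilityMeasure (densityMeasure (f t)) :=
  (H.law t ht).isProbabilityMeasure_iff.1 inferInstance

theorem continuousOn_dissipationIntegrand (H : IsAnnealedDynamics I π πt s f P X)
    (hI : UniqueDiffOn ℝ I) (hπ : ContDiff ℝ 1 π) (hπ₀ : ∀ x, 0 < π x)
    (hπt : ContinuousOn (fun z : ℝ × Space d => score (πt z.1) z.2) (I ×ˢ univ)) :
    ContinuousOn (fun z : ℝ × Space d =>
      inner ℝ (s z.1 z.2 - score (πt z.1) z.2) (relScore (f z.1) π z.2)) (I ×ˢ univ) :=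
  (H.continuousOn_field.sub hπt).inner (continuousOn_relScore hI H.contDiffOn H.pos hπ hπ₀)

theorem integrable_mul_dissipationIntegrand (H : IsAnnealedDynamics I π πt s f P X)
    (hI : UniqueDiffOn ℝ I) (hπ : ContDiff ℝ 1 π) (hπ₀ : ∀ x, 0 < π x)
    (hπt : ContinuousOn (fun z : ℝ × Space d => score (πt z.1) z.2) (I ×ˢ univ))
    {t : ℝ} (ht : t ∈ I) :
    Integrable fun x => f t x * inner ℝ (s t x - score (πt t) x) (relScore (f t) π x) := by
  obtain ⟨g, hg, hgt⟩ := H.dominated_dissipation t ht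
  refine hg.mono' ?_ (ae_of_all _ fun x => ?_)
  · exact ((contDiff_space H.contDiffOn ht).continuous.mul
      ((H.continuousOn_dissipationIntegrand hI hπ hπ₀ hπt).continuous_slice
        (G := fun t x => inner ℝ (s t x - score (πt t) x) (relScore (f t) π x))
        ht)).aestronglyMeasurable
  · rw [Real.norm_eq_abs, abs_mul, abs_of_pos (H.pos t ht x)]
    exact hgt.self_of_nhdsWithin ht x

theorem dissipation_eq (H : IsAnnealedDynamics I π πt s f P X) {t : ℝ} (ht : t ∈ I) :
    dissipation (s t) (πt t) π (f t) =
      ∫ x, f t x * inner ℝ (s t x - score (πt t) x) (relScore (f t) π x) :=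
  integral_densityMeasure (H.measurable_density ht) (H.pos t ht) _

theorem continuousOn_dissipation (H : IsAnnealedDynamics I π πt s f P X)
    (hI : UniqueDiffOn ℝ I) (hπ : ContDiff ℝ 1 π) (hπ₀ : ∀ x, 0 < π x)
    (hπt : ContinuousOn (fun z : ℝ × Space d => score (πt z.1) z.2) (I ×ˢ univ)) :
    ContinuousOn (fun t => dissipation (s t) (πt t) π (f t)) I := by
  refine ContinuousOn.congr (fun t ht => ?_) fun t ht => H.dissipation_eq ht
  obtain ⟨g, hg, hgt⟩ := H.dominated_dissipation t ht
  refine tendsto_integral_filter_of_dominated_convergence g ?_ ?_ hg (ae_of_all _ fun x => ?_)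
  · filter_upwards [self_mem_nhdsWithin] with τ hτ
    exact (H.integrable_mul_dissipationIntegrand hI hπ hπ₀ hπt hτ).aestronglyMeasurable
  · filter_upwards [hgt, self_mem_nhdsWithin] with τ hτ hτI
    refine ae_of_all _ fun x => ?_
    rw [Real.norm_eq_abs, abs_mul, abs_of_pos (H.pos τ hτI x)]
    exact hτ x
  · have h := (H.contDiffOn.continuousOn.mul
      (H.continuousOn_dissipationIntegrand hI hπ hπ₀ hπt)).comp_path
      (G := fun t x => f t x * inner ℝ (s t x - score (πt t) x) (relScore (f t) π x))
      subset_rfl (continuousOn_const (c := x))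
    exact h t ht

theorem exists_majorant_deriv (H : IsAnnealedDynamics I π πt s f P X) {a b : ℝ}
    (hsub : Icc a b ⊆ I) : ∃ g : Space d → ℝ, Integrable g ∧
      ∀ t ∈ Icc a b, ∀ x, |derivWithin (fun τ => f τ x) I t| ≤ g x :=
  isCompact_Icc.exists_integrable_majorant hsub H.dominated_deriv

theorem exists_majorant_dissipation (H : IsAnnealedDynamics I π πt s f P X) {a b : ℝ}
    (hsub : Icc a b ⊆ I) : ∃ g : Space d → ℝ, Integrable g ∧ ∀ t ∈ Icc a b, ∀ x,
      |f t x * inner ℝ (s t x - score (πt t) x) (relScore (f t) π x)| ≤ g x := by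
  refine isCompact_Icc.exists_integrable_majorant hsub
    (Z := fun t x => f t x * inner ℝ (s t x - score (πt t) x) (relScore (f t) π x)) fun t ht => ?_
  obtain ⟨g, hg, hgt⟩ := H.dominated_dissipation t ht
  refine ⟨g, hg, ?_⟩
  filter_upwards [hgt, self_mem_nhdsWithin] with τ hτ hτI x
  rw [abs_mul, abs_of_pos (H.pos τ hτI x)]
  exact hτ x

theorem continuous_derivWithin (H : IsAnnealedDynamics I π πt s f P X) (hI : UniqueDiffOn ℝ I)
    {t : ℝ} (ht : t ∈ I) : Continuous fun x => derivWithin (fun τ => f τ x) I t :=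
  (continuousOn_derivWithin_time hI H.contDiffOn).continuous_slice
    (G := fun t x => derivWithin (fun τ => f τ x) I t) ht

theorem integrable_derivWithin (H : IsAnnealedDynamics I π πt s f P X) (hI : UniqueDiffOn ℝ I)
    {t : ℝ} (ht : t ∈ I) : Integrable fun x => derivWithin (fun τ => f τ x) I t := by
  obtain ⟨g, hg, hgt⟩ := H.dominated_deriv t ht
  exact hg.mono' (H.continuous_derivWithin hI ht).aestronglyMeasurable
    (ae_of_all _ fun x => hgt.self_of_nhdsWithin ht x)

/-- Conservation of mass. -/
theorem integral_integral_derivWithin [IsProbabilityMeasure P]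
    (H : IsAnnealedDynamics I π πt s f P X) (hI : UniqueDiffOn ℝ I) {a b : ℝ} (hab : a ≤ b)
    (hsub : Icc a b ⊆ I) : ∫ t in a..b, ∫ x, derivWithin (fun τ => f τ x) I t = 0 := by
  obtain ⟨g, hg, hgt⟩ := H.exists_majorant_deriv hsub
  have hc := continuousOn_derivWithin_time hI H.contDiffOn
  have hmeas : AEStronglyMeasurable
      (Function.uncurry fun t x => derivWithin (fun τ => f τ x) I t)
      ((volume.restrict (Ioc a b)).prod (volume : Measure (Space d))) := by
    -- The process that stays at its starting point, on space with Lebesgue measure, turns the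
    -- probabilistic lemma into a deterministic one.
    exact aestronglyMeasurable_uncurry_comp_process (X := fun _ x => x) hab
      (G := fun t x => derivWithin (fun τ => f τ x) I t)
      (hc.mono (prod_mono_left hsub)) (fun _ _ => aemeasurable_id)
      (ae_of_all _ fun _ => continuousOn_const)
  have key := integrable_and_integral_eq_of_ae_eq_intervalIntegral hab hmeas
    (C := ∫ x, g x) (W := fun x => f b x - f a x)
    (fun t ht => H.integrable_derivWithin hI (hsub (Ioc_subset_Icc_self ht)))
    (fun t ht => integral_mono
      (H.integrable_derivWithin hI (hsub (Ioc_subset_Icc_self ht))).norm hg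
      fun x => hgt t (Ioc_subset_Icc_self ht) x)
    (ae_of_all _ fun x => (intervalIntegral_eq_sub_of_hasDerivWithinAt hab hsub
      (fun t ht => (hasDerivWithinAt_time H.contDiffOn ht x).differentiableWithinAt.hasDerivWithinAt)
      (hc.comp_path (G := fun t x => derivWithin (fun τ => f τ x) I t) hsub
        (continuousOn_const (c := x)))).symm)
  have ha := hsub (left_mem_Icc.2 hab)
  have hb := hsub (right_mem_Icc.2 hab)
  have := H.isProbabilityMeasure ha
  have := H.isProbabilityMeasure hb
  obtain ⟨ia, ea⟩ := integrable_and_integral_eq_one (H.measurable_density ha) (H.pos a ha)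
  obtain ⟨ib, eb⟩ := integrable_and_integral_eq_one (H.measurable_density hb) (H.pos b hb)
  rw [← key.2.2, integral_sub ib ia, ea, eb, sub_self]

/-- The path derivative of the log-ratio is integrated over time and then over `Ω`. Only the
difference is claimed integrable, so no finite entropy is assumed. -/
theorem integrable_and_integral_log_ratio_sub [IsProbabilityMeasure P]
    (H : IsAnnealedDynamics I π πt s f P X)
    (hI : UniqueDiffOn ℝ I) (hπ : ContDiff ℝ 1 π) (hπ₀ : ∀ x, 0 < π x)
    (hπt : ContinuousOn (fun z : ℝ × Space d => score (πt z.1) z.2) (I ×ˢ univ))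
    {a b : ℝ} (hab : a ≤ b) (hsub : Icc a b ⊆ I) :
    Integrable (fun ω => Real.log (f b (X b ω) / π (X b ω)) -
        Real.log (f a (X a ω) / π (X a ω))) P ∧
      ∫ ω, (Real.log (f b (X b ω) / π (X b ω)) - Real.log (f a (X a ω) / π (X a ω))) ∂P =
        -∫ t in a..b, dissipation (s t) (πt t) π (f t) := by
  obtain ⟨g₁, hg₁, hgt₁⟩ := H.exists_majorant_deriv hsub
  obtain ⟨g₂, hg₂, hgt₂⟩ := H.exists_majorant_dissipation hsub
  let φ : ℝ → Space d → ℝ := fun t x => derivWithin (fun τ => f τ x) I t / f t x -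
    inner ℝ (s t x - score (πt t) x) (relScore (f t) π x)
  have hφ : ContinuousOn (fun z : ℝ × Space d => φ z.1 z.2) (I ×ˢ univ) :=
    ((continuousOn_derivWithin_time hI H.contDiffOn).div H.contDiffOn.continuousOn
      fun z hz => (H.pos z.1 hz.1 z.2).ne').sub
      (H.continuousOn_dissipationIntegrand hI hπ hπ₀ hπt)
  -- The weight `f t` of the law cancels the division by `f t`, so that the two majorants control
  -- `φ` in `L¹` of the law.
  have hfφ : ∀ t ∈ I, (fun x => f t x * φ t x) = fun x => derivWithin (fun τ => f τ x) I t -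
      f t x * inner ℝ (s t x - score (πt t) x) (relScore (f t) π x) := by
    intro t ht
    funext x
    have := (H.pos t ht x).ne'
    simp only [φ]
    field_simp
  have hφi : ∀ t ∈ I, Integrable (φ t) (densityMeasure (f t)) := by
    intro t ht
    rw [integrable_densityMeasure_iff (H.measurable_density ht) (H.pos t ht), hfφ t ht]
    exact (H.integrable_derivWithin hI ht).sub
      (H.integrable_mul_dissipationIntegrand hI hπ hπ₀ hπt ht)
  have hXi : ∀ t ∈ I, Integrable (fun ω => φ t (X t ω)) P := by
    intro t ht
    have h := hφi t ht
    rw [← (H.law t ht).map_eq] at h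
    exact h.comp_aemeasurable (H.law t ht).aemeasurable
  have hXc : ∀ᵐ ω ∂P, ContinuousOn (fun t => X t ω) (Icc a b) := by
    filter_upwards [H.ode] with ω hω t ht
    exact (hω t (hsub ht)).continuousWithinAt.mono hsub
  have hbound : ∀ t ∈ Ioc a b, ∫ ω, ‖φ t (X t ω)‖ ∂P ≤ ∫ x, g₁ x + g₂ x := by
    intro t ht
    have htI := hsub (Ioc_subset_Icc_self ht)
    have h := (H.law t htI).integral_comp (hφi t htI).norm.aestronglyMeasurable
    simp only [Function.comp_def] at h
    rw [h, integral_densityMeasure (H.measurable_density htI) (H.pos t htI)]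
    refine integral_mono ?_ (hg₁.add hg₂) fun x => ?_
    · exact (integrable_densityMeasure_iff (H.measurable_density htI) (H.pos t htI)).1
        (hφi t htI).norm
    · have e := congrFun (hfφ t htI) x
      simp only at e ⊢
      rw [Real.norm_eq_abs, ← abs_of_pos (H.pos t htI x), ← abs_mul, e]
      exact (abs_sub _ _).trans (add_le_add (hgt₁ t (Ioc_subset_Icc_self ht) x)
        (hgt₂ t (Ioc_subset_Icc_self ht) x))
  have key := integrable_and_integral_eq_of_ae_eq_intervalIntegral hab
    (aestronglyMeasurable_uncurry_comp_process hab (hφ.mono (prod_mono_left hsub))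
      (fun t ht => (H.law t (hsub ht)).aemeasurable) hXc)
    (fun t ht => hXi t (hsub (Ioc_subset_Icc_self ht))) hbound
    (W := fun ω => Real.log (f b (X b ω) / π (X b ω)) - Real.log (f a (X a ω) / π (X a ω))) (by
      filter_upwards [H.ode, hXc] with ω hω hωc
      refine (intervalIntegral_eq_sub_of_hasDerivWithinAt hab hsub
        (G := fun t => Real.log (f t (X t ω) / π (X t ω))) (fun t ht => ?_)
        (hφ.comp_path hsub hωc)).symm
      refine (hasDerivWithinAt_log_div_comp_path hI H.contDiffOn H.pos hπ hπ₀ ht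
        (hω t ht)).congr_deriv ?_
      rw [← neg_sub (s t _), inner_neg_left, ← sub_eq_add_neg])
  refine ⟨key.1, ?_⟩
  have hD : IntervalIntegrable (fun t => dissipation (s t) (πt t) π (f t)) volume a b :=
    ((H.continuousOn_dissipation hI hπ hπ₀ hπt).mono
      (by rwa [uIcc_of_le hab])).intervalIntegrable
  -- Adding the dissipation leaves only the rate of change of mass, whose time integral is zero.
  have e : ∀ t ∈ uIcc a b, ∫ ω, φ t (X t ω) ∂P + dissipation (s t) (πt t) π (f t) =
      ∫ x, derivWithin (fun τ => f τ x) I t := by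
    intro t ht
    have htI := hsub (by rwa [uIcc_of_le hab] at ht)
    have h := (H.law t htI).integral_comp (hφi t htI).aestronglyMeasurable
    simp only [Function.comp_def] at h
    rw [h, integral_densityMeasure (H.measurable_density htI) (H.pos t htI), hfφ t htI,
      integral_sub (H.integrable_derivWithin hI htI)
        (H.integrable_mul_dissipationIntegrand hI hπ hπ₀ hπt htI), H.dissipation_eq htI]
    ring
  rw [key.2.2, eq_neg_iff_add_eq_zero, ← intervalIntegral.integral_add key.2.1 hD,
    intervalIntegral.integral_congr e, H.integral_integral_derivWithin hI hab hsub]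

end IsAnnealedDynamics

/-! ### Relative entropy along the flow, and the score-matching error. -/

namespace IsAnnealedDynamics

variable {d : ℕ} {I : Set ℝ} {π : Space d → ℝ} {πt : ℝ → Space d → ℝ}
  {s : ℝ → Space d → Space d} {f : ℝ → Space d → ℝ} {Ω : Type*} [MeasurableSpace Ω]
  {P : Measure Ω} {X : ℝ → Ω → Space d}

theorem measurable_log_ratio (H : IsAnnealedDynamics I π πt s f P X) (hπ : ContDiff ℝ 1 π)
    {t : ℝ} (ht : t ∈ I) : Measurable fun x => Real.log (f t x / π x) :=
  ((H.measurable_density ht).div hπ.continuous.measurable).log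

theorem integrable_log_ratio_comp_iff [IsProbabilityMeasure P]
    (H : IsAnnealedDynamics I π πt s f P X)
    (hπ : ContDiff ℝ 1 π) (hπ₀ : ∀ x, 0 < π x) {t : ℝ} (ht : t ∈ I) :
    Integrable (fun ω => Real.log (f t (X t ω) / π (X t ω))) P ↔
      klDiv (densityMeasure (f t)) (densityMeasure π) ≠ ∞ := by
  have := H.isProbabilityMeasure ht
  rw [klDiv_densityMeasure_ne_top_iff (H.measurable_density ht) (H.pos t ht)
    hπ.continuous.measurable hπ₀, ← (H.law t ht).map_eq,
    integrable_map_measure (H.measurable_log_ratio hπ ht).aestronglyMeasurable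
      (H.law t ht).aemeasurable]
  rfl

theorem integral_log_ratio_comp [IsProbabilityMeasure P]
    (H : IsAnnealedDynamics I π πt s f P X) (hπ : ContDiff ℝ 1 π) (hπ₀ : ∀ x, 0 < π x)
    (hπ₁ : ∫ x, π x = 1) {t : ℝ} (ht : t ∈ I) :
    ∫ ω, Real.log (f t (X t ω) / π (X t ω)) ∂P = relEntropy (f t) π := by
  have := H.isProbabilityMeasure ht
  have := isProbabilityMeasure_densityMeasure hπ₀ hπ₁
  rw [relEntropy_eq_integral (H.measurable_density ht) (H.pos t ht)
    hπ.continuous.measurable hπ₀]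
  exact (H.law t ht).integral_comp (H.measurable_log_ratio hπ ht).aestronglyMeasurable

/-- The log-ratio at `X_t` differs from the one at the time of finite entropy by an integrable
variable, whichever of the two times comes first. -/
theorem klDiv_ne_top [IsProbabilityMeasure P] (H : IsAnnealedDynamics I π πt s f P X)
    (hI : I.OrdConnected) (hI' : I.Nontrivial) (hπ : ContDiff ℝ 1 π) (hπ₀ : ∀ x, 0 < π x)
    (hπt : ContinuousOn (fun z : ℝ × Space d => score (πt z.1) z.2) (I ×ˢ univ))
    {t : ℝ} (ht : t ∈ I) : klDiv (densityMeasure (f t)) (densityMeasure π) ≠ ∞ := by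
  have hU := hI.uniqueDiffOn_real hI'
  obtain ⟨t₀, ht₀, h₀⟩ := H.finite_entropy
  rw [← H.integrable_log_ratio_comp_iff hπ hπ₀ ht₀] at h₀
  rw [← H.integrable_log_ratio_comp_iff hπ hπ₀ ht]
  rcases le_total t₀ t with h | h
  · exact ((H.integrable_and_integral_log_ratio_sub hU hπ hπ₀ hπt h
      (hI.out ht₀ ht)).1.add h₀).congr (ae_of_all _ fun ω => sub_add_cancel _ _)
  · exact (h₀.sub (H.integrable_and_integral_log_ratio_sub hU hπ hπ₀ hπt h
      (hI.out ht ht₀)).1).congr (ae_of_all _ fun ω => sub_sub_cancel _ _)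

/-- The integrated form of the entropy dissipation identity. -/
theorem relEntropy_sub_eq_intervalIntegral [IsProbabilityMeasure P]
    (H : IsAnnealedDynamics I π πt s f P X)
    (hI : I.OrdConnected) (hI' : I.Nontrivial) (hπ : ContDiff ℝ 1 π) (hπ₀ : ∀ x, 0 < π x)
    (hπ₁ : ∫ x, π x = 1)
    (hπt : ContinuousOn (fun z : ℝ × Space d => score (πt z.1) z.2) (I ×ˢ univ))
    {t u : ℝ} (ht : t ∈ I) (hu : u ∈ I) :
    relEntropy (f u) π - relEntropy (f t) π =
      -∫ r in t..u, dissipation (s r) (πt r) π (f r) := by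
  wlog htu : t ≤ u generalizing t u
  · rw [intervalIntegral.integral_symm, ← this hu ht (le_of_not_ge htu), neg_sub]
  have hU := hI.uniqueDiffOn_real hI'
  have key := (H.integrable_and_integral_log_ratio_sub hU hπ hπ₀ hπt htu (hI.out ht hu)).2
  rw [← key, integral_sub
    ((H.integrable_log_ratio_comp_iff hπ hπ₀ hu).2 (H.klDiv_ne_top hI hI' hπ hπ₀ hπt hu))
    ((H.integrable_log_ratio_comp_iff hπ hπ₀ ht).2 (H.klDiv_ne_top hI hI' hπ hπ₀ hπt ht)),
    H.integral_log_ratio_comp hπ hπ₀ hπ₁ hu, H.integral_log_ratio_comp hπ hπ₀ hπ₁ ht]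

/-- The entropy dissipation identity. -/
theorem hasDerivWithinAt_relEntropy [IsProbabilityMeasure P]
    (H : IsAnnealedDynamics I π πt s f P X)
    (hI : I.OrdConnected) (hI' : I.Nontrivial) (hπ : ContDiff ℝ 1 π) (hπ₀ : ∀ x, 0 < π x)
    (hπ₁ : ∫ x, π x = 1)
    (hπt : ContinuousOn (fun z : ℝ × Space d => score (πt z.1) z.2) (I ×ˢ univ))
    {t : ℝ} (ht : t ∈ I) :
    HasDerivWithinAt (fun τ => relEntropy (f τ) π) (-dissipation (s t) (πt t) π (f t)) I t := by
  have hc := H.continuousOn_dissipation (hI.uniqueDiffOn_real hI') hπ hπ₀ hπt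
  refine hasDerivWithinAt_of_eq_intervalIntegral hI hc.neg ht fun u hu => ?_
  simp only [Pi.neg_apply, intervalIntegral.integral_neg]
  exact H.relEntropy_sub_eq_intervalIntegral hI hI' hπ hπ₀ hπ₁ hπt ht hu

theorem integrable_dissipationIntegrand (H : IsAnnealedDynamics I π πt s f P X)
    (hI : UniqueDiffOn ℝ I) (hπ : ContDiff ℝ 1 π) (hπ₀ : ∀ x, 0 < π x)
    (hπt : ContinuousOn (fun z : ℝ × Space d => score (πt z.1) z.2) (I ×ˢ univ))
    {t : ℝ} (ht : t ∈ I) :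
    Integrable (fun x => inner ℝ (s t x - score (πt t) x) (relScore (f t) π x))
      (densityMeasure (f t)) :=
  (integrable_densityMeasure_iff (H.measurable_density ht) (H.pos t ht)).2
    (H.integrable_mul_dissipationIntegrand hI hπ hπ₀ hπt ht)

/-- The dissipation differs from its ideal value by at most `√(L F)`. -/
theorem integrable_inner_relScore_and_abs_dissipation_sub_le
    (H : IsAnnealedDynamics I π πt s f P X)
    (hI : UniqueDiffOn ℝ I) (hπ : ContDiff ℝ 1 π) (hπ₀ : ∀ x, 0 < π x)
    (hπt₀ : ∀ t ∈ I, ∀ x, 0 < πt t x) (hπt₁ : ∀ t ∈ I, Differentiable ℝ (πt t))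
    (hπt : ContinuousOn (fun z : ℝ × Space d => score (πt z.1) z.2) (I ×ˢ univ))
    {t : ℝ} (ht : t ∈ I) (h : scoreLoss (s t) (f t) * relFisher (f t) π ≠ ∞) :
    Integrable (fun x => inner ℝ (relScore (f t) (πt t) x) (relScore (f t) π x))
        (densityMeasure (f t)) ∧
      |dissipation (s t) (πt t) π (f t) - ∫ x, inner ℝ (relScore (f t) (πt t) x)
          (relScore (f t) π x) ∂(densityMeasure (f t))| ≤
        √(scoreLoss (s t) (f t) * relFisher (f t) π).toReal := by
  have hf := contDiff_space H.contDiffOn ht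
  have hs : Continuous (s t) := H.continuousOn_field.continuous_slice ht
  have hr : Continuous (relScore (f t) π) :=
    (continuousOn_relScore hI H.contDiffOn H.pos hπ hπ₀).continuous_slice
      (G := fun t x => relScore (f t) π x) ht
  obtain ⟨hi, hle⟩ := integrable_inner_and_abs_integral_inner_le
    (hs.sub (continuous_score hf (H.pos t ht))).aestronglyMeasurable hr.aestronglyMeasurable h
  simp only [Pi.sub_apply] at hi hle
  have hd := H.integrable_dissipationIntegrand hI hπ hπ₀ hπt ht
  -- Here `∇ log f_t` is inserted between `s_t` and `∇ log π_t`. The ideal integrand thus becomes a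
  -- difference of two integrable ones, and the error is exactly the Cauchy–Schwarz term.
  have e : (fun x => inner ℝ (relScore (f t) (πt t) x) (relScore (f t) π x)) =
      fun x => inner ℝ (s t x - score (πt t) x) (relScore (f t) π x) -
        inner ℝ (s t x - score (f t) x) (relScore (f t) π x) := by
    funext x
    rw [relScore_eq (hf.differentiable one_ne_zero x) (hπt₁ t ht x) (H.pos t ht) (hπt₀ t ht),
      ← inner_sub_left, sub_sub_sub_cancel_left]
  rw [e]
  refine ⟨hd.sub hi, ?_⟩
  rw [integral_sub hd hi, dissipation, sub_sub_cancel]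
  exact hle

end IsAnnealedDynamics

/-! ### The main theorem. -/

theorem mainTheorem4 {d : ℕ}
    -- the time interval
    (I : Set ℝ) (hI : I.OrdConnected) (hI' : I.Nontrivial)
    -- the target probability density `π`
    (π : Space d → ℝ) (hπ_pos : ∀ x, 0 < π x) (hπ_smooth : ContDiff ℝ 1 π)
    (hπ_mass : ∫ x, π x = 1)
    -- the annealing path `π_t`
    (πt : ℝ → Space d → ℝ) (hπt_pos : ∀ t ∈ I, ∀ x, 0 < πt t x)
    (hπt_diff : ∀ t ∈ I, Differentiable ℝ (πt t))
    (hπt_score : ContinuousOn (fun z : ℝ × Space d => score (πt z.1) z.2) (I ×ˢ univ))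
    -- a family of vector fields `s`, densities `f` and processes `X`
    {ι : Type*} (s : ι → ℝ → Space d → Space d) (f : ι → ℝ → Space d → ℝ)
    {Ω : ι → Type*} [∀ i, MeasurableSpace (Ω i)] (P : ∀ i, Measure (Ω i))
    [∀ i, IsProbabilityMeasure (P i)] (X : ∀ i, ℝ → Ω i → Space d)
    (hX : ∀ i, IsAnnealedDynamics I π πt (s i) (f i) (P i) (X i)) :
    -- the dissipation identity and the bound, for each member of the family and each time
    (∀ i, ∀ t ∈ I,
      klDiv (densityMeasure (f i t)) (densityMeasure π) ≠ ∞ ∧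
      Integrable (fun x => inner ℝ (s i t x - score (πt t) x) (relScore (f i t) π x))
        (densityMeasure (f i t)) ∧
      HasDerivWithinAt (fun τ => relEntropy (f i τ) π)
        (-∫ x, inner ℝ (s i t x - score (πt t) x) (relScore (f i t) π x)
          ∂(densityMeasure (f i t))) I t ∧
      (scoreLoss (s i t) (f i t) * relFisher (f i t) π ≠ ∞ →
        Integrable (fun x => inner ℝ (relScore (f i t) (πt t) x) (relScore (f i t) π x))
          (densityMeasure (f i t)) ∧
        |(∫ x, inner ℝ (s i t x - score (πt t) x) (relScore (f i t) π x)
              ∂(densityMeasure (f i t)))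
            - ∫ x, inner ℝ (relScore (f i t) (πt t) x) (relScore (f i t) π x)
              ∂(densityMeasure (f i t))|
          ≤ √(scoreLoss (s i t) (f i t) * relFisher (f i t) π).toReal)) ∧
    -- convergence at the rate `O(√L)` as the loss tends to zero along the family
    (∀ (l : Filter ι) (t : ι → ℝ), (∀ i, t i ∈ I) →
      (∃ C : ℝ≥0, ∀ᶠ i in l, relFisher (f i (t i)) π ≤ C) →
      Tendsto (fun i => scoreLoss (s i (t i)) (f i (t i))) l (𝓝 0) →
      Tendsto (fun i => -derivWithin (fun τ => relEntropy (f i τ) π) I (t i)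
          - ∫ x, inner ℝ (relScore (f i (t i)) (πt (t i)) x) (relScore (f i (t i)) π x)
            ∂(densityMeasure (f i (t i)))) l (𝓝 0) ∧
      (fun i => -derivWithin (fun τ => relEntropy (f i τ) π) I (t i)
          - ∫ x, inner ℝ (relScore (f i (t i)) (πt (t i)) x) (relScore (f i (t i)) π x)
            ∂(densityMeasure (f i (t i))))
        =O[l] fun i => √(scoreLoss (s i (t i)) (f i (t i))).toReal) := by
  have hU := hI.uniqueDiffOn_real hI'
  have hderiv : ∀ i, ∀ t ∈ I, HasDerivWithinAt (fun τ => relEntropy (f i τ) π)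
      (-dissipation (s i t) (πt t) π (f i t)) I t := fun i t ht =>
    (hX i).hasDerivWithinAt_relEntropy hI hI' hπ_smooth hπ_pos hπ_mass hπt_score ht
  have hbound := fun i t ht =>
    (hX i).integrable_inner_relScore_and_abs_dissipation_sub_le hU hπ_smooth hπ_pos hπt_pos
      hπt_diff hπt_score (t := t) ht
  refine ⟨fun i t ht => ⟨(hX i).klDiv_ne_top hI hI' hπ_smooth hπ_pos hπt_score ht,
    (hX i).integrable_dissipationIntegrand hU hπ_smooth hπ_pos hπt_score ht, hderiv i t ht,
    hbound i t ht⟩, ?_⟩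
  rintro l t ht ⟨C, hC⟩ hL
  have hO : (fun i => -derivWithin (fun τ => relEntropy (f i τ) π) I (t i)
      - ∫ x, inner ℝ (relScore (f i (t i)) (πt (t i)) x) (relScore (f i (t i)) π x)
        ∂(densityMeasure (f i (t i))))
      =O[l] fun i => √(scoreLoss (s i (t i)) (f i (t i))).toReal := by
    refine IsBigO.of_bound √C ?_
    -- A loss tending to zero is eventually finite, so the product with the bounded Fisher
    -- information is finite and the estimate applies.
    filter_upwards [hC, hL.eventually_lt_const ENNReal.zero_lt_top] with i hCi hLi
    have hFi : relFisher (f i (t i)) π ≠ ∞ := (hCi.trans_lt ENNReal.coe_lt_top).ne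
    rw [(hderiv i _ (ht i)).derivWithin (hU _ (ht i)), neg_neg, Real.norm_eq_abs,
      Real.norm_of_nonneg (Real.sqrt_nonneg _)]
    refine (hbound i _ (ht i) (ENNReal.mul_ne_top hLi.ne hFi)).2.trans ?_
    rw [ENNReal.toReal_mul, mul_comm, Real.sqrt_mul ENNReal.toReal_nonneg]
    gcongr
    exact ENNReal.toReal_le_coe_of_le_coe hCi
  refine ⟨hO.trans_tendsto ?_, hO⟩
  have := (Real.continuous_sqrt.tendsto _).comp
    ((ENNReal.tendsto_toReal ENNReal.zero_ne_top).comp hL)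
  simpa [Function.comp_def] using this
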